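/- An orthomodular lattice (OML) is a bounded lattice $(L,\wedge,\vee,0,1)$ with an order-inverting unary operation $a\mapsto a'$ such that $a''=a$, $a\wedge a'=0$ and $a\vee a'=1$ for all $a\in L$, and $a\vee(a'\wedge b)=b$ whenever $a\le b$. A subalgebra of $L$ is a subset containing $0,1$ and closed under $\wedge,\vee,{}'$; $\mathrm{Sub}(L)$ is the lattice of all subalgebras of $L$ ordered by inclusion. A subalgebra is Boolean if it is distributive, and a block of $L$ is a maximal Boolean subalgebra of $L$. Theorem. Let $L$ and $M$ be OMLs, each with at least two elements, and let $\varphi\colon\mathrm{Sub}(L)\to\mathrm{Sub}(M)$ be a lattice isomorphism. Then there is an OML isomorphism $\varphi^*\colon L\to M$ (a lattice isomorphism with $\varphi^*(a')=\varphi^*(a)'$ for all $a\in L$) such that $\varphi^*[x]=\varphi(x)$ for every subalgebra $x$ of $L$. Moreover, if $L$ has no block with exactly four elements, then the OML isomorphism $\varphi^*$ with this property is unique. -/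

import Mathlib

/-- An orthomodular lattice: a bounded lattice with an order-inverting involution `ᶜ` sending each
element to a complement of it, such that `b = a ⊔ (aᶜ ⊓ b)` whenever `a ≤ b`. -/
class OrthomodularLattice (L : Type*) extends Lattice L, BoundedOrder L, Compl L where
  compl_compl (a : L) : aᶜᶜ = a
  compl_le_compl (a b : L) : a ≤ b → bᶜ ≤ aᶜ
  inf_compl_self (a : L) : a ⊓ aᶜ = ⊥
  sup_compl_self (a : L) : a ⊔ aᶜ = ⊤
  orthomodular (a b : L) : a ≤ b → a ⊔ (aᶜ ⊓ b) = b

/-- An isomorphism of orthomodular lattices: an isomorphism of lattices (which automatically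
preserves the bounds) that preserves the orthocomplementation. -/
structure OMLIso (L M : Type*) [OrthomodularLattice L] [OrthomodularLattice M] extends
    L ≃o M where
  map_compl (a : L) : toFun aᶜ = (toFun a)ᶜ

instance OMLIso.instCoeFun (L M : Type*) [OrthomodularLattice L] [OrthomodularLattice M] :
    CoeFun (OMLIso L M) (fun _ => L → M) where
  coe f := f.toFun

/-- A subalgebra of an orthomodular lattice: a subset containing `0` and `1` and closed under
the lattice operations and the orthocomplementation. `OMLSub L` is `Sub(L)`. -/
structure OMLSub (L : Type*) [OrthomodularLattice L] where
  carrier : Set L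
  bot_mem : ⊥ ∈ carrier
  top_mem : ⊤ ∈ carrier
  sup_mem {a b : L} : a ∈ carrier → b ∈ carrier → a ⊔ b ∈ carrier
  inf_mem {a b : L} : a ∈ carrier → b ∈ carrier → a ⊓ b ∈ carrier
  compl_mem {a : L} : a ∈ carrier → aᶜ ∈ carrier

namespace OMLSub

instance instSetLike (L : Type*) [OrthomodularLattice L] : SetLike (OMLSub L) L where
  coe x := x.carrier
  coe_injective x y h := by cases x; cases y; congr

/-- Subalgebras are ordered by inclusion. -/
instance instPartialOrder (L : Type*) [OrthomodularLattice L] : PartialOrder (OMLSub L) :=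
  .ofSetLike (OMLSub L) L

/-- The intersection of a family of subalgebras. -/
instance instInfSet (L : Type*) [OrthomodularLattice L] : InfSet (OMLSub L) where
  sInf S :=
    { carrier := {a | ∀ x ∈ S, a ∈ x}
      bot_mem := fun x _ => x.bot_mem
      top_mem := fun x _ => x.top_mem
      sup_mem := fun ha hb x hx => x.sup_mem (ha x hx) (hb x hx)
      inf_mem := fun ha hb x hx => x.inf_mem (ha x hx) (hb x hx)
      compl_mem := fun ha x hx => x.compl_mem (ha x hx) }

/-- `Sub(L)` is a complete lattice under inclusion, with intersections as meets. -/
instance instCompleteLattice (L : Type*) [OrthomodularLattice L] : CompleteLattice (OMLSub L) :=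
  completeLatticeOfInf (OMLSub L) fun S =>
    ⟨fun x hx _ ha => ha x hx, fun _ hy _ ha x hx => hy hx ha⟩

/-- A subalgebra is Boolean if, with the induced operations, it is a Boolean algebra, that is,
if it is distributive. -/
def IsBoolean {L : Type*} [OrthomodularLattice L] (x : OMLSub L) : Prop :=
  ∀ a ∈ x, ∀ b ∈ x, ∀ c ∈ x, a ⊓ (b ⊔ c) = (a ⊓ b) ⊔ (a ⊓ c)

/-- A block is a maximal Boolean subalgebra. -/
def IsBlock {L : Type*} [OrthomodularLattice L] (x : OMLSub L) : Prop :=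
  Maximal IsBoolean x

end OMLSub

/-! The atoms of `OMLSub L` are the `gen a` with `a` nontrivial, so `φ` determines an image of each
`a` up to complementation; the problem is to orient these choices. The data come from triads: up to
complements, they are the lines of three atoms (`collinear_of_triad`, `exists_triad_of_collinear`),
hence `φ` preserves them. Two triads through the atom `gen a` may contain `a` and `aᶜ` respectively,
or the same one of the two; `OppositeAt` separates the cases in purely lattice-theoretic terms
(`opposite_of_triad`, `not_opposite_of_triad`). So the images of all triads containing `a` contain
one common element `x`, the oriented image of `a`. Strict inequalities between nontrivial elements
are encoded by triads (`triad_of_lt`), so oriented images chosen compatibly with complements form an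
isomorphism. The orientation is forced at `a` once `a` or `aᶜ` lies in a triad; otherwise `gen a` is
a four-element block. -/

namespace OrthomodularLattice

variable {L : Type*} [OrthomodularLattice L]

/-! ### Orthocomplements and the orthomodular law -/

theorem compl_le_compl_iff {a b : L} : aᶜ ≤ bᶜ ↔ b ≤ a :=
  ⟨fun h => by simpa only [compl_compl] using compl_le_compl _ _ h, compl_le_compl _ _⟩

theorem le_compl_swap {a b : L} : a ≤ bᶜ ↔ b ≤ aᶜ := by
  rw [← compl_le_compl_iff, compl_compl]

theorem compl_inj_iff {a b : L} : aᶜ = bᶜ ↔ a = b :=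
  ⟨fun h => by rw [← compl_compl a, h, compl_compl], fun h => h ▸ rfl⟩

theorem sup_compl_eq (a b : L) : (a ⊔ b)ᶜ = aᶜ ⊓ bᶜ :=
  le_antisymm (le_inf (compl_le_compl _ _ le_sup_left) (compl_le_compl _ _ le_sup_right))
    (le_compl_swap.2 (sup_le (le_compl_swap.2 inf_le_left) (le_compl_swap.2 inf_le_right)))

theorem bot_compl : (⊥ : L)ᶜ = ⊤ := by
  simpa using sup_compl_self (⊥ : L)

theorem top_compl : (⊤ : L)ᶜ = ⊥ := by
  simpa using inf_compl_self (⊤ : L)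

theorem compl_sup_self_eq (a : L) : aᶜ ⊔ a = ⊤ := by
  rw [sup_comm, sup_compl_self]

theorem compl_inf_self_eq (a : L) : aᶜ ⊓ a = ⊥ := by
  rw [inf_comm, inf_compl_self]

theorem compl_eq_bot_iff {a : L} : aᶜ = ⊥ ↔ a = ⊤ := by
  rw [← compl_inj_iff, compl_compl, bot_compl]

theorem compl_eq_top_iff {a : L} : aᶜ = ⊤ ↔ a = ⊥ := by
  rw [← compl_inj_iff, compl_compl, top_compl]

theorem eq_bot_of_le_of_le_compl {a b : L} (h : a ≤ b) (h' : a ≤ bᶜ) : a = ⊥ :=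
  le_bot_iff.1 ((le_inf h h').trans (inf_compl_self b).le)

theorem eq_of_le_of_sup_compl_eq_top {a b : L} (h : a ≤ b) (h' : a ⊔ bᶜ = ⊤) : a = b := by
  have := orthomodular a b h
  rwa [← compl_compl b, ← sup_compl_eq, compl_compl, h', top_compl, sup_bot_eq] at this

/-- De Morgan gives one inequality. The orthomodular law in `[⊥, a]` and `[⊥, aᶜ]` makes the join
with `u ⊔ v` equal to `⊤`, which forces equality. -/
theorem compl_sup_eq_of_le {a u v : L} (hu : u ≤ a) (hv : v ≤ aᶜ) :
    (u ⊔ v)ᶜ = (uᶜ ⊓ a) ⊔ (vᶜ ⊓ aᶜ) := by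
  symm
  apply eq_of_le_of_sup_compl_eq_top
  · rw [sup_compl_eq]
    refine sup_le (le_inf inf_le_left ?_) (le_inf ?_ inf_le_left)
    · exact inf_le_right.trans (le_compl_swap.1 hv)
    · exact inf_le_right.trans (compl_le_compl _ _ hu)
  · have h1 := orthomodular u a hu
    have h2 := orthomodular v aᶜ hv
    calc _ = (u ⊔ (uᶜ ⊓ a)) ⊔ (v ⊔ (vᶜ ⊓ aᶜ)) := by rw [compl_compl]; ac_rfl
      _ = ⊤ := by rw [h1, h2, sup_compl_self]

/-! ### Triads and interval subalgebras -/

/-- Three nonzero elements form a triad if they are the atoms of an eight-element Boolean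
subalgebra, that is, if they are pairwise orthogonal with join `⊤`. -/
structure Triad (a b c : L) : Prop where
  ne₁ : a ≠ ⊥
  ne₂ : b ≠ ⊥
  ne₃ : c ≠ ⊥
  le : a ≤ bᶜ
  compl_eq : cᶜ = a ⊔ b

theorem triad_of_orthogonal {a b : L} (ha : a ≠ ⊥) (hb : b ≠ ⊥) (h : a ≤ bᶜ) (h' : a ⊔ b ≠ ⊤) :
    Triad a b (a ⊔ b)ᶜ :=
  ⟨ha, hb, fun h0 => h' (compl_eq_bot_iff.1 h0), h, compl_compl _⟩

theorem triad_of_lt {a b : L} (ha : a ≠ ⊥) (hb : b ≠ ⊤) (h : a ≤ b) (h' : a ≠ b) :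
    Triad a bᶜ (a ⊔ bᶜ)ᶜ :=
  triad_of_orthogonal ha (fun h0 => hb (compl_eq_bot_iff.1 h0)) (by rwa [compl_compl])
    fun h0 => h' (eq_of_le_of_sup_compl_eq_top h h0)

namespace Triad

variable {a b c : L}

theorem swap (h : Triad a b c) : Triad b a c :=
  ⟨h.ne₂, h.ne₁, h.ne₃, le_compl_swap.1 h.le, by rw [h.compl_eq, sup_comm]⟩

theorem swap_right (h : Triad a b c) : Triad a c b := by
  refine ⟨h.ne₁, h.ne₃, h.ne₂, h.compl_eq ▸ le_sup_left, ?_⟩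
  have := orthomodular a bᶜ h.le
  rwa [← sup_compl_eq, ← h.compl_eq, compl_compl, eq_comm] at this

theorem ne_top (h : Triad a b c) : a ≠ ⊤ := fun h0 =>
  h.ne₂ (compl_eq_top_iff.1 (top_le_iff.1 (h0 ▸ h.le)))

theorem le_right (h : Triad a b c) : b ≤ aᶜ := h.swap.le

theorem ne (h : Triad a b c) : a ≠ b := fun h0 =>
  h.ne₁ (eq_bot_of_le_of_le_compl le_rfl (by simpa [h0] using h.le))

theorem ne_compl (h : Triad a b c) : a ≠ bᶜ := fun h0 =>
  h.ne₃ (compl_eq_top_iff.1 (by rw [h.compl_eq, h0, compl_sup_self_eq]))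

theorem sup_eq (h : Triad a b c) : b ⊔ c = aᶜ := by
  rw [sup_comm, h.swap_right.swap.swap_right.compl_eq]

theorem mem (h : Triad a b c) {x : OMLSub L} (ha : a ∈ x) (hb : b ∈ x) : c ∈ x := by
  rw [← compl_compl c, h.compl_eq]
  exact x.compl_mem (x.sup_mem ha hb)

end Triad

/-- A set of elements below `a` closed under the operations of the interval `[⊥, a]`. -/
structure IsIntervalSub (a : L) (A : Set L) : Prop where
  bot_mem : ⊥ ∈ A
  le : ∀ u ∈ A, u ≤ a
  sup_mem : ∀ u ∈ A, ∀ v ∈ A, u ⊔ v ∈ A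
  compl_mem : ∀ u ∈ A, uᶜ ⊓ a ∈ A

theorem isIntervalSub_pair (a : L) : IsIntervalSub a {⊥, a} where
  bot_mem := by simp
  le := by simp
  sup_mem := by simp
  compl_mem := by simp [bot_compl, inf_comm aᶜ, inf_compl_self]

theorem Triad.isIntervalSub {a b c : L} (h : Triad a b c) :
    IsIntervalSub aᶜ {⊥, b, c, aᶜ} := by
  have hb : b ≤ aᶜ := h.le_right
  have hc : c ≤ aᶜ := h.swap_right.le_right
  have h1 : bᶜ ⊓ aᶜ = c := by
    rw [← sup_compl_eq, sup_comm, ← h.compl_eq, compl_compl]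
  have h2 : cᶜ ⊓ aᶜ = b := by
    rw [← sup_compl_eq, sup_comm, ← h.swap_right.compl_eq, compl_compl]
  have h3 : b ⊔ c = aᶜ := h.sup_eq
  have h4 : c ⊔ b = aᶜ := by rw [sup_comm, h3]
  refine ⟨by simp, ?_, ?_, ?_⟩
  · simp [hb, hc]
  · simp [hb, hc, h3, h4]
  · simp [bot_compl, h1, h2, compl_compl, inf_compl_self]

end OrthomodularLattice

open OrthomodularLattice

/-! ### Constructing subalgebras; the atoms of `OMLSub L` -/

namespace OMLSub

variable {L : Type*} [OrthomodularLattice L]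

/-- A set containing `⊥` closed under joins and complements is a subalgebra. -/
def ofSupCompl (s : Set L) (bot : ⊥ ∈ s) (sup : ∀ a ∈ s, ∀ b ∈ s, a ⊔ b ∈ s)
    (compl : ∀ a ∈ s, aᶜ ∈ s) : OMLSub L where
  carrier := s
  bot_mem := bot
  top_mem := bot_compl (L := L) ▸ compl _ bot
  sup_mem ha hb := sup _ ha _ hb
  inf_mem {a b} ha hb := by
    have := compl _ (sup _ (compl _ ha) _ (compl _ hb))
    rwa [sup_compl_eq, OrthomodularLattice.compl_compl, OrthomodularLattice.compl_compl] at this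
  compl_mem ha := compl _ ha

/-- The subalgebra of joins of elements of interval subalgebras of `[⊥, a]` and `[⊥, aᶜ]`. -/
def ofInterval {a : L} {A B : Set L} (hA : IsIntervalSub a A) (hB : IsIntervalSub aᶜ B) :
    OMLSub L :=
  ofSupCompl {z | ∃ u ∈ A, ∃ v ∈ B, u ⊔ v = z}
    ⟨⊥, hA.bot_mem, ⊥, hB.bot_mem, by simp⟩
    (by
      rintro _ ⟨u, hu, v, hv, rfl⟩ _ ⟨u', hu', v', hv', rfl⟩
      exact ⟨_, hA.sup_mem u hu u' hu', _, hB.sup_mem v hv v' hv', by ac_rfl⟩)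
    (by
      rintro _ ⟨u, hu, v, hv, rfl⟩
      exact ⟨_, hA.compl_mem u hu, _, hB.compl_mem v hv,
        (compl_sup_eq_of_le (hA.le u hu) (hB.le v hv)).symm⟩)

section ofInterval

variable {a : L} {A B : Set L} (hA : IsIntervalSub a A) (hB : IsIntervalSub aᶜ B) {z : L}

theorem mem_ofInterval_left (hz : z ∈ A) : z ∈ ofInterval hA hB :=
  ⟨z, hz, ⊥, hB.bot_mem, by simp⟩

theorem mem_ofInterval_right (hz : z ∈ B) : z ∈ ofInterval hA hB :=
  ⟨⊥, hA.bot_mem, z, hz, by simp⟩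

theorem mem_left_of_mem_ofInterval (hz : z ∈ ofInterval hA hB) (h : z ≤ a) : z ∈ A := by
  obtain ⟨u, hu, v, hv, rfl⟩ := hz
  have : v = ⊥ := eq_bot_of_le_of_le_compl (le_sup_right.trans h) (hB.le v hv)
  simpa [this] using hu

theorem mem_right_of_mem_ofInterval (hz : z ∈ ofInterval hA hB) (h : z ≤ aᶜ) : z ∈ B := by
  obtain ⟨u, hu, v, hv, rfl⟩ := hz
  have : u = ⊥ := eq_bot_of_le_of_le_compl (hA.le u hu) (le_sup_left.trans h)
  simpa [this] using hv

end ofInterval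

/-- The subalgebra generated by one element. -/
def gen (a : L) : OMLSub L :=
  ofSupCompl {⊥, ⊤, a, aᶜ} (by simp)
    (by simp [sup_compl_self, compl_sup_self_eq])
    (by simp [bot_compl, top_compl, OrthomodularLattice.compl_compl])

theorem mem_gen {a z : L} : z ∈ gen a ↔ z = ⊥ ∨ z = ⊤ ∨ z = a ∨ z = aᶜ := Iff.rfl

theorem self_mem_gen (a : L) : a ∈ gen a := by simp [mem_gen]

theorem gen_le {a : L} {x : OMLSub L} : gen a ≤ x ↔ a ∈ x := by
  refine ⟨fun h => h (self_mem_gen a), fun h z hz => ?_⟩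
  rcases mem_gen.1 hz with rfl | rfl | rfl | rfl
  exacts [x.bot_mem, x.top_mem, h, x.compl_mem h]

theorem gen_compl (a : L) : gen aᶜ = gen a :=
  le_antisymm (gen_le.2 ((gen a).compl_mem (self_mem_gen a)))
    (gen_le.2 (by
      simp [mem_gen, OrthomodularLattice.compl_compl]))

theorem gen_bot : gen (⊥ : L) = ⊥ := le_bot_iff.1 (gen_le.2 (⊥ : OMLSub L).bot_mem)

theorem gen_top : gen (⊤ : L) = ⊥ := le_bot_iff.1 (gen_le.2 (⊥ : OMLSub L).top_mem)

theorem gen_eq_bot {a : L} : gen a = ⊥ ↔ a = ⊥ ∨ a = ⊤ := by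
  refine ⟨fun h => ?_, ?_⟩
  · have := gen_le.1 (h.le.trans (bot_le : _ ≤ gen (⊥ : L)))
    rw [mem_gen, bot_compl] at this
    tauto
  · rintro (rfl | rfl)
    exacts [gen_bot, gen_top]

theorem eq_or_eq_compl_of_gen_eq {a b : L} (ha : a ≠ ⊥) (ha' : a ≠ ⊤) (h : gen a = gen b) :
    a = b ∨ a = bᶜ := by
  simpa [mem_gen, ha, ha'] using gen_le.1 h.le

theorem isAtom_gen {a : L} (ha : a ≠ ⊥) (ha' : a ≠ ⊤) : IsAtom (gen a) := by
  refine ⟨fun h => (gen_eq_bot.1 h).elim ha ha', fun x hx => ?_⟩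
  refine le_bot_iff.1 fun z hz => ?_
  rcases mem_gen.1 (hx.le hz) with rfl | rfl | rfl | rfl
  · exact (⊥ : OMLSub L).bot_mem
  · exact (⊥ : OMLSub L).top_mem
  · exact absurd (gen_le.2 hz) hx.not_ge
  · exact absurd (gen_compl a ▸ gen_le.2 hz) hx.not_ge

theorem exists_gen_eq_of_isAtom {p : OMLSub L} (hp : IsAtom p) : ∃ a, gen a = p := by
  by_contra! h
  refine hp.1 (le_bot_iff.1 fun z hz => ?_)
  have h1 := (hp.le_iff.1 (gen_le.2 hz)).resolve_right (h z)
  exact gen_le.1 h1.le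

theorem ne_of_isAtom_gen {a : L} (h : IsAtom (gen a)) : a ≠ ⊥ ∧ a ≠ ⊤ := by
  have := h.1
  rwa [Ne, gen_eq_bot, not_or] at this

end OMLSub

/-! ### Lines and orientation in an abstract lattice -/

section Collinear

variable {α β : Type*} [CompleteLattice α] [CompleteLattice β]

/-- Three distinct atoms are collinear if they are precisely the atoms below the join of the first
two. -/
structure Collinear3 (p q r : α) : Prop where
  atom₁ : IsAtom p
  atom₂ : IsAtom q
  atom₃ : IsAtom r
  ne₁₂ : p ≠ q
  ne₁₃ : p ≠ r
  ne₂₃ : q ≠ r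
  le : r ≤ p ⊔ q
  eq_of_le : ∀ s, IsAtom s → s ≤ p ⊔ q → s = p ∨ s = q ∨ s = r

theorem Collinear3.map (φ : α ≃o β) {p q r : α} (h : Collinear3 p q r) :
    Collinear3 (φ p) (φ q) (φ r) where
  atom₁ := (φ.isAtom_iff p).2 h.atom₁
  atom₂ := (φ.isAtom_iff q).2 h.atom₂
  atom₃ := (φ.isAtom_iff r).2 h.atom₃
  ne₁₂ := φ.injective.ne h.ne₁₂
  ne₁₃ := φ.injective.ne h.ne₁₃
  ne₂₃ := φ.injective.ne h.ne₂₃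
  le := by rw [← map_sup, φ.le_iff_le]; exact h.le
  eq_of_le s hs hle := by
    obtain ⟨s, rfl⟩ := φ.surjective s
    rw [← map_sup, φ.le_iff_le] at hle
    simpa using h.eq_of_le s ((φ.isAtom_iff s).1 hs) hle

/-- For distinct lines `p, q, r` and `p, s, t`, the property expressing that `p` has opposite
orientations in them. -/
structure OppositeAt (p q r s t : α) : Prop where
  ne₁ : s ≠ q
  ne₂ : s ≠ r
  collinear : ∃ u, Collinear3 q s u
  eq_of_le : ∀ u v, Collinear3 p u v → u ≤ p ⊔ q ⊔ s → u = q ∨ u = r ∨ u = s ∨ u = t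

theorem OppositeAt.map (φ : α ≃o β) {p q r s t : α} (h : OppositeAt p q r s t) :
    OppositeAt (φ p) (φ q) (φ r) (φ s) (φ t) where
  ne₁ := φ.injective.ne h.ne₁
  ne₂ := φ.injective.ne h.ne₂
  collinear := h.collinear.imp' φ fun _ hu => hu.map φ
  eq_of_le u v huv hle := by
    obtain ⟨u, rfl⟩ := φ.surjective u
    obtain ⟨v, rfl⟩ := φ.surjective v
    rw [← map_sup, ← map_sup, φ.le_iff_le] at hle
    have := huv.map φ.symm
    simp only [OrderIso.symm_apply_apply] at this
    simpa using h.eq_of_le u v this hle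

end Collinear

/-! ### Triads as oriented lines -/

namespace OMLSub

variable {L : Type*} [OrthomodularLattice L]

theorem gen_ne_of_triad {a b c : L} (h : Triad a b c) : gen a ≠ gen b := fun h0 =>
  (eq_or_eq_compl_of_gen_eq h.ne₁ h.ne_top h0).elim h.ne h.ne_compl

theorem isAtom_gen_of_triad {a b c : L} (h : Triad a b c) : IsAtom (gen a) :=
  isAtom_gen h.ne₁ h.ne_top

theorem mem_gen_sup_left (a b : L) : a ∈ gen a ⊔ gen b := gen_le.1 le_sup_left

theorem mem_gen_sup_right (a b : L) : b ∈ gen a ⊔ gen b := gen_le.1 le_sup_right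

theorem collinear_of_triad {a b c : L} (h : Triad a b c) :
    Collinear3 (gen a) (gen b) (gen c) where
  atom₁ := isAtom_gen_of_triad h
  atom₂ := isAtom_gen_of_triad h.swap
  atom₃ := isAtom_gen_of_triad h.swap_right.swap
  ne₁₂ := gen_ne_of_triad h
  ne₁₃ := gen_ne_of_triad h.swap_right
  ne₂₃ := gen_ne_of_triad h.swap.swap_right
  le := gen_le.2 (h.mem (mem_gen_sup_left a b) (mem_gen_sup_right a b))
  eq_of_le s hs hle := by
    obtain ⟨z, rfl⟩ := exists_gen_eq_of_isAtom hs
    have hz : z ∈ ofInterval (isIntervalSub_pair a) h.isIntervalSub := by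
      refine gen_le.1 (hle.trans (sup_le (gen_le.2 ?_) (gen_le.2 ?_)))
      · exact mem_ofInterval_left _ _ (by simp)
      · exact mem_ofInterval_right _ _ (by simp)
    obtain ⟨u, hu, v, hv, rfl⟩ := hz
    obtain ⟨hs1, hs2⟩ := ne_of_isAtom_gen hs
    rcases hu with rfl | rfl <;> rcases hv with rfl | rfl | rfl | rfl
    · simp at hs1
    · simp
    · simp
    · simp [gen_compl]
    · simp
    · simp [← h.compl_eq, gen_compl]
    · simp [← h.swap_right.compl_eq, gen_compl]
    · simp [sup_compl_self] at hs2

theorem triad_of_collinear_of_orthogonal {a b c x y : L}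
    (h : Collinear3 (gen a) (gen b) (gen c)) (hx : gen x = gen a) (hy : gen y = gen b)
    (hxy : x ≤ yᶜ) : Triad x y (x ⊔ y)ᶜ ∧ gen (x ⊔ y)ᶜ = gen c := by
  have hx0 := ne_of_isAtom_gen (hx ▸ h.atom₁)
  have hy0 := ne_of_isAtom_gen (hy ▸ h.atom₂)
  have ht : Triad x y (x ⊔ y)ᶜ := by
    refine triad_of_orthogonal hx0.1 hy0.1 hxy fun h0 => h.ne₁₂ ?_
    rw [← hx, ← hy, ← gen_compl y]
    congr 1
    exact eq_of_le_of_sup_compl_eq_top hxy (by rwa [OrthomodularLattice.compl_compl])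
  refine ⟨ht, ?_⟩
  have h1 : gen (x ⊔ y)ᶜ ≤ gen a ⊔ gen b := by
    rw [← hx, ← hy]
    exact gen_le.2 (ht.mem (mem_gen_sup_left x y) (mem_gen_sup_right x y))
  rcases h.eq_of_le _ (isAtom_gen_of_triad ht.swap_right.swap) h1 with h2 | h2 | h2
  · exact absurd (hx.trans h2.symm) (gen_ne_of_triad ht.swap_right)
  · exact absurd (hy.trans h2.symm) (gen_ne_of_triad ht.swap.swap_right)
  · exact h2

/-- If `x ≤ y`, then `x` is orthogonal to `yᶜ`. Otherwise `⊥ < x ⊓ y < x` yields a triad containing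
`xᶜ` and `x ⊓ y` inside the line, whose remaining members must represent the other two atoms. -/
theorem exists_triad_of_inf_ne_bot {a b c x y : L}
    (h : Collinear3 (gen a) (gen b) (gen c)) (hx : gen x = gen a) (hy : gen y = gen b)
    (hxy : x ⊓ y ≠ ⊥) :
    ∃ x y z, Triad x y z ∧ gen x = gen a ∧ gen y = gen b ∧ gen z = gen c := by
  have hx0 := ne_of_isAtom_gen (hx ▸ h.atom₁)
  have hx' : gen xᶜ = gen a := by rw [gen_compl, hx]
  by_cases hm : x ⊓ y = x
  · have hy' : gen yᶜ = gen b := by rw [gen_compl, hy]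
    obtain ⟨h1, h2⟩ := triad_of_collinear_of_orthogonal h hx hy'
      (by rw [OrthomodularLattice.compl_compl]; exact inf_eq_left.1 hm)
    exact ⟨_, _, _, h1, hx, hy', h2⟩
  have ht := (triad_of_lt hxy hx0.2 inf_le_left hm).swap
  have hmem : x ⊓ y ∈ gen a ⊔ gen b := by
    rw [← hx, ← hy]
    exact (gen x ⊔ gen y).inf_mem (mem_gen_sup_left x y) (mem_gen_sup_right x y)
  rcases h.eq_of_le _ (isAtom_gen_of_triad ht.swap) (gen_le.2 hmem) with h2 | h2 | h2
  · exact absurd (hx'.trans h2.symm) (gen_ne_of_triad ht)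
  · obtain ⟨h3, h4⟩ := triad_of_collinear_of_orthogonal h hx' h2 ht.le
    exact ⟨_, _, _, h3, hx', h2, h4⟩
  · have hmem' := ht.mem ((gen a ⊔ gen b).compl_mem (gen_le.1 (hx.le.trans le_sup_left))) hmem
    rcases h.eq_of_le _ (isAtom_gen_of_triad ht.swap_right.swap) (gen_le.2 hmem')
      with h3 | h3 | h3
    · exact absurd (hx'.trans h3.symm) (gen_ne_of_triad ht.swap_right)
    · exact ⟨_, _, _, ht.swap_right, hx', h3, h2⟩
    · exact absurd (h2.trans h3.symm) (gen_ne_of_triad ht.swap.swap_right)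

theorem exists_triad_of_collinear {a b c : L} (h : Collinear3 (gen a) (gen b) (gen c)) :
    ∃ x y z, Triad x y z ∧ gen x = gen a ∧ gen y = gen b ∧ gen z = gen c := by
  by_contra hn
  have key : ∀ x y, gen x = gen a → gen y = gen b → x ⊓ y = ⊥ := fun x y hx hy =>
    by_contra fun h0 => hn (exists_triad_of_inf_ne_bot h hx hy h0)
  have key' : ∀ x y, gen x = gen a → gen y = gen b → x ⊔ y = ⊤ := fun x y hx hy => by
    have := key xᶜ yᶜ (by rw [gen_compl, hx]) (by rw [gen_compl, hy])
    rwa [← sup_compl_eq, compl_eq_bot_iff] at this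
  have h1 : a ⊔ b = ⊤ := key' _ _ rfl rfl
  have h2 : aᶜ ⊔ b = ⊤ := key' _ _ (gen_compl a) rfl
  have h3 : a ⊔ bᶜ = ⊤ := key' _ _ rfl (gen_compl b)
  have h4 : aᶜ ⊔ bᶜ = ⊤ := key' _ _ (gen_compl a) (gen_compl b)
  have h5 : b ⊔ a = ⊤ := sup_comm a b ▸ h1
  have h6 : b ⊔ aᶜ = ⊤ := sup_comm aᶜ b ▸ h2
  have h7 : bᶜ ⊔ a = ⊤ := sup_comm a bᶜ ▸ h3
  have h8 : bᶜ ⊔ aᶜ = ⊤ := sup_comm aᶜ bᶜ ▸ h4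
  -- All mixed meets are `⊥` and all mixed joins `⊤`, so these six elements are closed; they leave
  -- no room for the third atom.
  let X : OMLSub L := ofSupCompl {⊥, ⊤, a, aᶜ, b, bᶜ} (by simp)
    (by simp [sup_compl_self, compl_sup_self_eq, h1, h2, h3, h4, h5, h6, h7, h8])
    (by simp [bot_compl, top_compl, OrthomodularLattice.compl_compl])
  have hX : ∀ z, z ∈ X ↔ z = ⊥ ∨ z = ⊤ ∨ z = a ∨ z = aᶜ ∨ z = b ∨ z = bᶜ := fun z => Iff.rfl
  have hc : c ∈ X := gen_le.1 (h.le.trans (sup_le (gen_le.2 (by simp [hX]))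
    (gen_le.2 (by simp [hX]))))
  have hc0 := ne_of_isAtom_gen h.atom₃
  rcases (hX c).1 hc with h0 | h0 | h0 | h0 | h0 | h0
  · exact hc0.1 h0
  · exact hc0.2 h0
  · exact h.ne₁₃ (h0 ▸ rfl)
  · exact h.ne₁₃ (by rw [h0, gen_compl])
  · exact h.ne₂₃ (h0 ▸ rfl)
  · exact h.ne₂₃ (by rw [h0, gen_compl])

/-- Since `d ≤ a ≤ bᶜ`, the elements `b` and `d` extend to a triad. The subalgebra generated by `a`,
`b`, `d` lies in the product of the intervals `{⊥, d, e, a}` and `{⊥, b, c, aᶜ}`, and any partner of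
`a` or `aᶜ` in a triad falls in one factor. -/
theorem opposite_of_triad {a b c d e : L} (h : Triad a b c) (h' : Triad aᶜ d e) :
    OppositeAt (gen a) (gen b) (gen c) (gen d) (gen e) := by
  have hd : d ≤ a := by simpa only [OrthomodularLattice.compl_compl] using h'.le_right
  have orth : ∀ {b c}, Triad a b c → Triad d b (d ⊔ b)ᶜ := fun {b c} h => by
    refine triad_of_orthogonal h'.ne₂ h.ne₂ (hd.trans h.le) fun h0 => h.ne₃ ?_
    rw [← compl_eq_top_iff, h.compl_eq, ← top_le_iff, ← h0]
    exact sup_le_sup_right hd b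
  have hA : IsIntervalSub a {⊥, d, e, a} := by
    simpa only [OrthomodularLattice.compl_compl] using h'.isIntervalSub
  refine ⟨gen_ne_of_triad (orth h), gen_ne_of_triad (orth h.swap_right),
    ⟨_, collinear_of_triad (orth h).swap⟩, fun u v huv hle => ?_⟩
  obtain ⟨u, rfl⟩ := exists_gen_eq_of_isAtom huv.atom₂
  obtain ⟨v, rfl⟩ := exists_gen_eq_of_isAtom huv.atom₃
  obtain ⟨x, y, z, ht, hx, hy, hz⟩ := exists_triad_of_collinear huv
  have hyS : y ∈ ofInterval hA h.isIntervalSub := by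
    rw [← gen_le, hy]
    refine hle.trans (sup_le (sup_le (gen_le.2 ?_) (gen_le.2 ?_)) (gen_le.2 ?_))
    · exact mem_ofInterval_left _ _ (by simp)
    · exact mem_ofInterval_right _ _ (by simp)
    · exact mem_ofInterval_left _ _ (by simp)
  rw [← hy]
  have hyx := ht.le_right
  rcases eq_or_eq_compl_of_gen_eq ht.ne₁ ht.ne_top hx with rfl | rfl
  · rcases mem_right_of_mem_ofInterval _ _ hyS hyx with h0 | h0 | h0 | h0
    · exact absurd h0 ht.ne₂
    · simp [h0]
    · simp [h0]
    · exact absurd h0.symm ht.swap.ne_compl.symm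
  · rw [OrthomodularLattice.compl_compl] at hyx
    rcases mem_left_of_mem_ofInterval _ _ hyS hyx with h0 | h0 | h0 | h0
    · exact absurd h0 ht.ne₂
    · simp [h0]
    · simp [h0]
    · exact absurd (by rw [h0]) ht.ne_compl

theorem gen_ne_of_triad_of_le {a x y z : L} (ht : Triad a x z) (hy : y ≤ aᶜ) (hne : x ≠ y) :
    gen x ≠ gen y := fun h0 => by
  rcases eq_or_eq_compl_of_gen_eq ht.ne₂ ht.swap.ne_top h0 with h1 | h1
  · exact hne h1
  · refine ht.ne₁ (eq_bot_of_le_of_le_compl (b := x) ?_ ht.le)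
    rw [h1]
    exact le_compl_swap.1 hy

/-- The witness is `x = b ⊔ d`: a further partner of `a`, new to both lines, which violates
`OppositeAt.eq_of_le`. -/
theorem exists_triad_of_orthogonal {a b c d e : L} (h : Triad a b c) (h' : Triad a d e)
    (hbd : b ≤ dᶜ) (hdc : d ≠ c) : ∃ x y, Triad a x y ∧
      (∀ S : OMLSub L, a ∈ S → b ∈ S → d ∈ S → x ∈ S) ∧
      gen x ≠ gen b ∧ gen x ≠ gen c ∧ gen x ≠ gen d ∧ gen x ≠ gen e := by
  have hle : a ≤ (b ⊔ d)ᶜ := le_compl_swap.1 (sup_le h.le_right h'.le_right)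
  have hdle : d ≤ c := by
    rw [← compl_compl c, h.compl_eq]
    exact le_compl_swap.1 (sup_le h'.le hbd)
  have hble : b ≤ e := by
    rw [← compl_compl e, h'.compl_eq]
    exact le_compl_swap.1 (sup_le h.le (le_compl_swap.1 hbd))
  have ht : Triad a (b ⊔ d) (a ⊔ (b ⊔ d))ᶜ := by
    refine triad_of_orthogonal h.ne₁ (fun h0 => h.ne₂ (le_bot_iff.1 (h0 ▸ le_sup_left))) hle
      fun h0 => hdc (eq_of_le_of_sup_compl_eq_top hdle ?_)
    rw [h.compl_eq, ← h0]
    ac_rfl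
  have hb : ¬ b ≤ d := fun h0 => h.ne₂ (eq_bot_of_le_of_le_compl h0 hbd)
  have hd : ¬ d ≤ b := fun h0 => h'.ne₂ (eq_bot_of_le_of_le_compl h0 (le_compl_swap.1 hbd))
  refine ⟨_, _, ht, fun S _ hb hd => S.sup_mem hb hd, gen_ne_of_triad_of_le ht h.le_right ?_,
    gen_ne_of_triad_of_le ht h.swap_right.le_right ?_, gen_ne_of_triad_of_le ht h'.le_right ?_,
    gen_ne_of_triad_of_le ht h'.swap_right.le_right ?_⟩
  · exact fun h0 => hd (h0 ▸ le_sup_right)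
  · exact fun h0 => h.ne₂ (eq_bot_of_le_of_le_compl (h0 ▸ le_sup_left) h.swap.swap_right.le)
  · exact fun h0 => hb (h0 ▸ le_sup_left)
  · exact fun h0 => h'.ne₂ (eq_bot_of_le_of_le_compl (h0 ▸ le_sup_right) h'.swap.swap_right.le)

theorem not_opposite_of_triad {a b c d e : L} (h : Triad a b c) (h' : Triad a d e) :
    ¬ OppositeAt (gen a) (gen b) (gen c) (gen d) (gen e) := fun ho => by
  have hdb : d ≠ b := fun h0 => ho.ne₁ (h0 ▸ rfl)
  have hdc : d ≠ c := fun h0 => ho.ne₂ (h0 ▸ rfl)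
  have hec : e ≠ c := fun h0 => hdb (by
    rw [← OrthomodularLattice.compl_inj_iff, h'.swap_right.compl_eq, h0, h.swap_right.compl_eq])
  have finish : ∀ {x y}, Triad a x y → (∀ S : OMLSub L, a ∈ S → b ∈ S → d ∈ S → x ∈ S) →
      gen x ≠ gen b → gen x ≠ gen c → gen x ≠ gen d → gen x ≠ gen e → False :=
    fun {x y} ht hS h1 h2 h3 h4 => by
      have := ho.eq_of_le _ _ (collinear_of_triad ht) (gen_le.2 (hS _
        (gen_le.1 (le_sup_left.trans le_sup_left)) (gen_le.1 (le_sup_right.trans le_sup_left))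
        (gen_le.1 le_sup_right)))
      tauto
  obtain ⟨u, hu⟩ := ho.collinear
  obtain ⟨u, rfl⟩ := exists_gen_eq_of_isAtom hu.atom₃
  obtain ⟨x, y, z, ht, hx, hy, -⟩ := exists_triad_of_collinear hu
  have hxy := ht.le
  -- Collinearity makes `b` or `bᶜ` orthogonal to `d` or `dᶜ`. Exchanging `d` with `e`, or `b` with
  -- `c`, reduces the two mixed cases to the first; in the last, `a ≤ bᶜ ≤ d` contradicts `a ≤ dᶜ`.
  rcases eq_or_eq_compl_of_gen_eq ht.ne₁ ht.ne_top hx with rfl | rfl <;>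
  rcases eq_or_eq_compl_of_gen_eq ht.ne₂ ht.swap.ne_top hy with rfl | rfl
  · obtain ⟨x, y, h0, h1, h2, h3, h4, h5⟩ := exists_triad_of_orthogonal h h' hxy hdc
    exact finish h0 h1 h2 h3 h4 h5
  · rw [OrthomodularLattice.compl_compl] at hxy
    have hle : x ≤ eᶜ := by rw [h'.compl_eq]; exact hxy.trans le_sup_right
    obtain ⟨x, y, h0, h1, h2, h3, h4, h5⟩ :=
      exists_triad_of_orthogonal h h'.swap_right hle hec
    exact finish h0 (fun S ha hb hd => h1 S ha hb (h'.mem ha hd)) h2 h3 h5 h4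
  · have hyb : y ≤ b := compl_le_compl_iff.1 hxy
    have hle : c ≤ yᶜ := (compl_le_compl_iff.2 hyb).trans' h.swap.swap_right.swap.le
    obtain ⟨x, y, h0, h1, h2, h3, h4, h5⟩ :=
      exists_triad_of_orthogonal h.swap_right h' hle hdb
    exact finish h0 (fun S ha hb hd => h1 S ha (h.mem ha hb) hd) h3 h2 h4 h5
  · rw [OrthomodularLattice.compl_compl] at hxy
    exact h.ne₁ (eq_bot_of_le_of_le_compl (h.le.trans hxy) h'.le)

end OMLSub

open OMLSub

/-! ### Oriented images and the induced isomorphism -/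

section Matching

variable {L M : Type*} [OrthomodularLattice L] [OrthomodularLattice M]
  {φ : OMLSub L ≃o OMLSub M}

theorem exists_map_gen_eq (φ : OMLSub L ≃o OMLSub M) (a : L) : ∃ x, φ (gen a) = gen x := by
  by_cases h : a = ⊥ ∨ a = ⊤
  · exact ⟨⊥, by rw [gen_eq_bot.2 h, map_bot, gen_bot]⟩
  · rw [not_or] at h
    obtain ⟨x, hx⟩ := exists_gen_eq_of_isAtom ((φ.isAtom_iff _).2 (isAtom_gen h.1 h.2))
    exact ⟨x, hx.symm⟩

theorem OrthomodularLattice.Triad.exists_map (φ : OMLSub L ≃o OMLSub M) {a b c : L}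
    (h : Triad a b c) : ∃ x y z, Triad x y z ∧
      φ (gen a) = gen x ∧ φ (gen b) = gen y ∧ φ (gen c) = gen z := by
  have hc := (collinear_of_triad h).map φ
  obtain ⟨x, hx⟩ := exists_map_gen_eq φ a
  obtain ⟨y, hy⟩ := exists_map_gen_eq φ b
  obtain ⟨z, hz⟩ := exists_map_gen_eq φ c
  rw [hx, hy, hz] at hc ⊢
  obtain ⟨x', y', z', ht, h1, h2, h3⟩ := exists_triad_of_collinear hc
  exact ⟨x', y', z', ht, h1.symm, h2.symm, h3.symm⟩

/-- The isomorphism `φ` carries triads containing `a` to triads containing `x`. -/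
def MapsTriads (φ : OMLSub L ≃o OMLSub M) (a : L) (x : M) : Prop :=
  ∀ b c, Triad a b c → ∃ y z, Triad x y z ∧ φ (gen b) = gen y ∧ φ (gen c) = gen z

/-- The element `x` is an image of `a` with the right orientation. -/
structure Matches (φ : OMLSub L ≃o OMLSub M) (a : L) (x : M) : Prop where
  map_gen : φ (gen a) = gen x
  eq_bot : a = ⊥ → x = ⊥
  eq_top : a = ⊤ → x = ⊤
  triads : MapsTriads φ a x
  triads_compl : MapsTriads φ aᶜ xᶜ

theorem Matches.compl {a : L} {x : M} (h : Matches φ a x) : Matches φ aᶜ xᶜ where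
  map_gen := by rw [gen_compl, gen_compl, h.map_gen]
  eq_bot h0 := by rw [compl_eq_bot_iff] at h0 ⊢; exact h.eq_top h0
  eq_top h0 := by rw [compl_eq_top_iff] at h0 ⊢; exact h.eq_bot h0
  triads := h.triads_compl
  triads_compl := by simpa only [OrthomodularLattice.compl_compl] using h.triads

/-- One triad fixes `x`. A second triad whose image had the wrong orientation relative to the first
would be opposite on exactly one side of `φ`. -/
theorem exists_matches_of_triad (φ : OMLSub L ≃o OMLSub M) {a b c : L} (h : Triad a b c) :
    ∃ x, Matches φ a x := by
  obtain ⟨x, y, z, ht, hx, hy, hz⟩ := h.exists_map φ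
  refine ⟨x, hx, fun h0 => absurd h0 h.ne₁, fun h0 => absurd h0 h.ne_top, ?_, ?_⟩
  · intro b' c' h'
    obtain ⟨x', y', z', ht', hx', hy', hz'⟩ := h'.exists_map φ
    rcases eq_or_eq_compl_of_gen_eq ht'.ne₁ ht'.ne_top (hx'.symm.trans hx) with rfl | rfl
    · exact ⟨y', z', ht', hy', hz'⟩
    · have := (opposite_of_triad ht ht').map φ.symm
      rw [← hx, ← hy, ← hz, ← hy', ← hz'] at this
      simp only [OrderIso.symm_apply_apply] at this
      exact absurd this (not_opposite_of_triad h h')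
  · intro b' c' h'
    obtain ⟨x', y', z', ht', hx', hy', hz'⟩ := h'.exists_map φ
    rw [gen_compl, hx] at hx'
    rcases eq_or_eq_compl_of_gen_eq ht'.ne₁ ht'.ne_top hx'.symm with rfl | rfl
    · have := (opposite_of_triad h h').map φ
      rw [hx, hy, hz, hy', hz'] at this
      exact absurd this (not_opposite_of_triad ht ht')
    · exact ⟨y', z', ht', hy', hz'⟩

theorem exists_matches [Nontrivial L] (φ : OMLSub L ≃o OMLSub M) (a : L) :
    ∃ x, Matches φ a x := by
  by_cases h : ∃ b c, Triad a b c
  · obtain ⟨b, c, h⟩ := h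
    exact exists_matches_of_triad φ h
  by_cases h' : ∃ b c, Triad aᶜ b c
  · obtain ⟨b, c, h'⟩ := h'
    obtain ⟨x, hx⟩ := exists_matches_of_triad φ h'
    exact ⟨xᶜ, by simpa only [OrthomodularLattice.compl_compl] using hx.compl⟩
  have h1 : ∀ x : M, MapsTriads φ a x := fun x b c ht => absurd ⟨b, c, ht⟩ h
  have h2 : ∀ x : M, MapsTriads φ aᶜ x := fun x b c ht => absurd ⟨b, c, ht⟩ h'
  -- `gen` does not distinguish `⊥` from `⊤`, so these are matched by hand; for any other `a`
  -- outside all triads either orientation is valid.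
  by_cases h3 : a = ⊥
  · exact ⟨⊥, by rw [h3, gen_bot, gen_bot, map_bot], fun _ => rfl,
      fun h0 => absurd (h3.symm.trans h0) bot_ne_top, h1 _, h2 _⟩
  by_cases h4 : a = ⊤
  · exact ⟨⊤, by rw [h4, gen_top, gen_top, map_bot], fun h0 => absurd h0 h3,
      fun _ => rfl, h1 _, h2 _⟩
  obtain ⟨x, hx⟩ := exists_map_gen_eq φ a
  exact ⟨x, hx, fun h0 => absurd h0 h3, fun h0 => absurd h0 h4, h1 _, h2 _⟩

theorem OrthomodularLattice.self_ne_compl [Nontrivial L] (a : L) : a ≠ aᶜ := fun h => by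
  have h1 : a = ⊥ := eq_bot_of_le_of_le_compl le_rfl h.le
  rw [h1, bot_compl] at h
  exact bot_ne_top h

/-- A choice of matching images compatible with complements. -/
structure IsMatching (φ : OMLSub L ≃o OMLSub M) (f : L → M) : Prop where
  map_compl : ∀ a, f aᶜ = (f a)ᶜ
  map : ∀ a, Matches φ a (f a)

theorem exists_isMatching [Nontrivial L] (φ : OMLSub L ≃o OMLSub M) :
    ∃ f : L → M, IsMatching φ f := by
  choose g hg using exists_matches φ
  classical
  -- A well-order selects one member of each pair `{a, aᶜ}`; its match determines that of the other.
  refine ⟨fun a => if WellOrderingRel a aᶜ then g a else (g aᶜ)ᶜ, fun a => ?_, fun a => ?_⟩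
  · have hne := self_ne_compl a
    rcases trichotomous_of WellOrderingRel a aᶜ with h | h | h
    · have h' : ¬ WellOrderingRel aᶜ a := fun h' => asymm_of WellOrderingRel h h'
      simp [OrthomodularLattice.compl_compl, h, h']
    · exact absurd h hne
    · have h' : ¬ WellOrderingRel a aᶜ := fun h' => asymm_of WellOrderingRel h h'
      simp [OrthomodularLattice.compl_compl, h, h']
  · split_ifs
    · exact hg a
    · simpa only [OrthomodularLattice.compl_compl] using (hg aᶜ).compl

/-- The match at `a` fixes `x` and leaves `y` up to complement; the match at `b` does the reverse.
If both had the wrong sign, then `x ≤ y` and `y ≤ x`, impossible since `x` and `yᶜ` lie in a triad.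
-/
theorem Matches.orthogonal {a b c : L} {x y : M} (hx : Matches φ a x) (hy : Matches φ b y)
    (h : Triad a b c) : x ≤ yᶜ := by
  obtain ⟨y', z, ht, hy', -⟩ := hx.triads _ _ h
  obtain ⟨x', z', ht', hx', -⟩ := hy.triads _ _ h.swap
  rw [hy.map_gen, eq_comm] at hy'
  rw [hx.map_gen, eq_comm] at hx'
  rcases eq_or_eq_compl_of_gen_eq ht.ne₂ ht.swap.ne_top hy' with rfl | rfl
  · exact ht.le
  rcases eq_or_eq_compl_of_gen_eq ht'.ne₂ ht'.swap.ne_top hx' with rfl | rfl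
  · exact ht'.le_right
  have h1 := ht.le
  have h2 := ht'.le
  rw [OrthomodularLattice.compl_compl] at h1 h2
  exact absurd (by rw [le_antisymm h1 h2]) ht.swap.ne_compl.symm

namespace IsMatching

variable {f : L → M} {a b c : L}

theorem map_bot (hf : IsMatching φ f) : f ⊥ = ⊥ := (hf.map ⊥).eq_bot rfl

theorem map_top (hf : IsMatching φ f) : f ⊤ = ⊤ := (hf.map ⊤).eq_top rfl

theorem orthogonal (hf : IsMatching φ f) (h : Triad a b c) : f a ≤ (f b)ᶜ := (hf.map a).orthogonal (hf.map b) h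

theorem injective (hf : IsMatching φ f) [Nontrivial M] : Function.Injective f := fun a b h => by
  have h1 : gen a = gen b := φ.injective (by rw [(hf.map a).map_gen, (hf.map b).map_gen, h])
  by_cases ha : a = bᶜ
  · rw [ha, hf.map_compl] at h
    exact absurd h.symm (self_ne_compl _)
  have h2 := gen_le.1 h1.le
  rcases mem_gen.1 h2 with rfl | rfl | h0 | h0
  · rcases gen_eq_bot.1 (h1.symm.trans gen_bot) with rfl | rfl
    · rfl
    · exact absurd top_compl.symm ha
  · rcases gen_eq_bot.1 (h1.symm.trans gen_top) with rfl | rfl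
    · exact absurd bot_compl.symm ha
    · rfl
  · exact h0
  · exact absurd h0 ha

theorem monotone (hf : IsMatching φ f) : Monotone f := fun a b h => by
  by_cases ha : a = ⊥
  · simp [ha, hf.map_bot]
  by_cases hb : b = ⊤
  · simp [hb, hf.map_top]
  by_cases hab : a = b
  · rw [hab]
  have := hf.orthogonal (triad_of_lt ha hb h hab)
  rwa [hf.map_compl, OrthomodularLattice.compl_compl] at this

theorem le_of_map_le (hf : IsMatching φ f) [Nontrivial M] (h : f a ≤ f b) : a ≤ b := by
  by_cases ha : f a = ⊥
  · simp [hf.injective (ha.trans hf.map_bot.symm)]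
  by_cases hb : f b = ⊤
  · simp [hf.injective (hb.trans hf.map_top.symm)]
  by_cases hab : f a = f b
  · rw [hf.injective hab]
  have ht := triad_of_lt ha hb h hab
  -- Pulled back, `a` or `aᶜ` is orthogonal to `b` or `bᶜ`. Monotonicity excludes every combination
  -- but `a ≤ bᶜᶜ`.
  obtain ⟨x, y, z, ht', hx, hy, -⟩ := ht.exists_map φ.symm
  rw [gen_compl, ← (hf.map b).map_gen, OrderIso.symm_apply_apply, eq_comm] at hy
  rw [← (hf.map a).map_gen, OrderIso.symm_apply_apply, eq_comm] at hx
  have hxy := ht'.le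
  rcases eq_or_eq_compl_of_gen_eq ht'.ne₁ ht'.ne_top hx with rfl | rfl <;>
  rcases eq_or_eq_compl_of_gen_eq ht'.ne₂ ht'.swap.ne_top hy with rfl | rfl
  · have := hf.monotone hxy
    rw [hf.map_compl] at this
    exact absurd (eq_bot_of_le_of_le_compl h this) ha
  · rwa [OrthomodularLattice.compl_compl] at hxy
  · exact absurd (le_antisymm h (hf.monotone (compl_le_compl_iff.1 hxy))) hab
  · have := hf.monotone hxy
    rw [OrthomodularLattice.compl_compl, hf.map_compl] at this
    refine absurd (top_le_iff.1 ?_) hb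
    rw [← sup_compl_self (f a)]
    exact sup_le h this

theorem surjective (hf : IsMatching φ f) : Function.Surjective f := fun x => by
  obtain ⟨a, ha⟩ := exists_map_gen_eq φ.symm x
  have h1 : gen x = gen (f a) := by
    rw [← (hf.map a).map_gen, ← ha, OrderIso.apply_symm_apply]
  rcases mem_gen.1 (gen_le.1 h1.le) with h | h | h | h
  · exact ⟨⊥, hf.map_bot.trans h.symm⟩
  · exact ⟨⊤, hf.map_top.trans h.symm⟩
  · exact ⟨a, h.symm⟩
  · exact ⟨aᶜ, by rw [hf.map_compl, h]⟩

theorem map_mem_iff (hf : IsMatching φ f) {x : OMLSub L} : f a ∈ φ x ↔ a ∈ x := by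
  rw [← gen_le, ← (hf.map a).map_gen, φ.le_iff_le, gen_le]

theorem image_eq (hf : IsMatching φ f) (x : OMLSub L) : f '' (x : Set L) = (φ x : Set M) := by
  ext y
  obtain ⟨a, rfl⟩ := hf.surjective y
  refine ⟨?_, fun h => ⟨a, hf.map_mem_iff.1 h, rfl⟩⟩
  rintro ⟨b, hb, h⟩
  exact h ▸ hf.map_mem_iff.2 hb

/-- The isomorphism of orthomodular lattices given by a matching. -/
noncomputable def toOMLIso (hf : IsMatching φ f) [Nontrivial M] : OMLIso L M where
  toEquiv := Equiv.ofBijective f ⟨hf.injective, hf.surjective⟩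
  map_rel_iff' := ⟨fun h => hf.le_of_map_le h, fun h => hf.monotone h⟩
  map_compl := hf.map_compl

end IsMatching

end Matching

/-! ### Uniqueness and four-element blocks -/

section Uniqueness

variable {L M : Type*} [OrthomodularLattice L] [OrthomodularLattice M]

theorem OMLIso.ext {f g : OMLIso L M} (h : ∀ a, f a = g a) : f = g := by
  cases f
  cases g
  congr
  exact DFunLike.ext _ _ h

theorem OMLIso.triad (f : OMLIso L M) {a b c : L} (h : Triad a b c) : Triad (f a) (f b) (f c) where
  ne₁ h0 := h.ne₁ ((map_eq_bot_iff f.toRelIso).1 h0)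
  ne₂ h0 := h.ne₂ ((map_eq_bot_iff f.toRelIso).1 h0)
  ne₃ h0 := h.ne₃ ((map_eq_bot_iff f.toRelIso).1 h0)
  le := (f.toRelIso.map_rel_iff.2 h.le).trans (f.map_compl b).le
  compl_eq := (f.map_compl c).symm.trans
    ((congrArg (fun z => f.toRelIso z) h.compl_eq).trans (map_sup f.toRelIso a b))

theorem OMLIso.eq_or_eq_compl {φ : OMLSub L ≃o OMLSub M} {f g : OMLIso L M}
    (hf : ∀ x : OMLSub L, f '' (x : Set L) = (φ x : Set M))
    (hg : ∀ x : OMLSub L, g '' (x : Set L) = (φ x : Set M)) (a : L) :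
    f a = g a ∨ f a = (g a)ᶜ := by
  have h1 : f a ∈ g '' (gen a : Set L) := by
    rw [hg, ← hf]
    exact ⟨a, self_mem_gen a, rfl⟩
  obtain ⟨b, hb, h⟩ := h1
  rcases mem_gen.1 hb with rfl | rfl | rfl | rfl
  · left
    have h0 : f a = ⊥ := h.symm.trans (map_bot g.toRelIso)
    rw [(map_eq_bot_iff f.toRelIso).1 h0]
    exact (map_bot f.toRelIso).trans (map_bot g.toRelIso).symm
  · left
    have h0 : f a = ⊤ := h.symm.trans (map_top g.toRelIso)
    rw [(map_eq_top_iff f.toRelIso).1 h0]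
    exact (map_top f.toRelIso).trans (map_top g.toRelIso).symm
  · exact Or.inl h.symm
  · exact Or.inr (h.symm.trans (g.map_compl a))

/-- If `f a = (g a)ᶜ`, orthogonality of `f a` and `f b` fails for both candidates for `f b`: `g b`
would be `⊥`, or equal to `(g a)ᶜ`. -/
theorem OMLIso.eq_of_triad {φ : OMLSub L ≃o OMLSub M} {f g : OMLIso L M}
    (hf : ∀ x : OMLSub L, f '' (x : Set L) = (φ x : Set M))
    (hg : ∀ x : OMLSub L, g '' (x : Set L) = (φ x : Set M)) {a b c : L} (h : Triad a b c) :
    f a = g a := by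
  refine (OMLIso.eq_or_eq_compl hf hg a).resolve_right fun ha => ?_
  have h1 := f.triad h
  have h2 := g.triad h
  have h3 := h1.le
  rw [ha] at h3
  rcases OMLIso.eq_or_eq_compl hf hg b with hb | hb
  · rw [hb] at h3
    exact h2.ne₂ (eq_bot_of_le_of_le_compl (compl_le_compl_iff.1 h3) h2.le_right)
  · rw [hb, OrthomodularLattice.compl_compl] at h3
    exact h2.swap.ne_compl (le_antisymm h2.le_right h3)

theorem OMLSub.isBoolean_gen (a : L) : IsBoolean (gen a) := by
  intro x hx y hy z hz
  rcases mem_gen.1 hx with rfl | rfl | rfl | rfl <;>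
  rcases mem_gen.1 hy with rfl | rfl | rfl | rfl <;>
  rcases mem_gen.1 hz with rfl | rfl | rfl | rfl <;>
  simp [OrthomodularLattice.sup_compl_self, compl_sup_self_eq,
    OrthomodularLattice.inf_compl_self, compl_inf_self_eq]

theorem OMLSub.isBlock_gen {a : L} (ha0 : a ≠ ⊥) (ha0' : a ≠ ⊤)
    (h : ∀ b c, ¬ Triad a b c) (h' : ∀ b c, ¬ Triad aᶜ b c) :
    IsBlock (gen a) := by
  have key : ∀ {a : L} {c : L}, a ≠ ⊤ → (∀ b c, ¬ Triad aᶜ b c) →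
      a ⊓ c ∈ gen a := fun {a c} ha h' => by
    by_cases h0 : a ⊓ c = ⊥
    · rw [h0]; exact (gen a).bot_mem
    by_cases h1 : a ⊓ c = a
    · rw [h1]; exact self_mem_gen a
    exact absurd (triad_of_lt h0 ha inf_le_left h1).swap (h' _ _)
  refine ⟨isBoolean_gen a, fun x hx hle c hc => ?_⟩
  have ha := gen_le.1 hle
  -- Distributivity splits `c` into its parts below `a` and `aᶜ`. Without triads each part is
  -- trivial, as one strictly between would give a triad by `triad_of_lt`.
  have hd := hx c hc a ha aᶜ (x.compl_mem ha)
  rw [OrthomodularLattice.sup_compl_self, inf_top_eq, inf_comm c, inf_comm c] at hd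
  rw [hd]
  refine (gen a).sup_mem (key ha0' h') ?_
  rw [← gen_compl]
  exact key (fun h0 => ha0 (compl_eq_top_iff.1 h0))
    (by simpa only [OrthomodularLattice.compl_compl] using h)

theorem OMLSub.ncard_gen [Nontrivial L] {a : L} (ha : a ≠ ⊥) (ha' : a ≠ ⊤) :
    (gen a : Set L).ncard = 4 := by
  have h : (gen a : Set L) = {⊥, ⊤, a, aᶜ} := rfl
  classical
  have h1 : aᶜ ≠ ⊥ := fun h => ha' (compl_eq_bot_iff.1 h)
  have h2 : aᶜ ≠ ⊤ := fun h => ha (compl_eq_top_iff.1 h)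
  have h3 : (gen a : Set L) = (({⊥, ⊤, a, aᶜ} : Finset L) : Set L) := by simp [h]
  rw [h3, Set.ncard_coe_finset]
  simp [ha.symm, ha'.symm, h1.symm, h2.symm, self_ne_compl a]

end Uniqueness

theorem mainTheorem2 {L : Type*} {M : Type*} [OrthomodularLattice L] [OrthomodularLattice M]
    [Nontrivial L] [Nontrivial M] (φ : OMLSub L ≃o OMLSub M) :
    (∃ f : OMLIso L M, ∀ x : OMLSub L, f '' (x : Set L) = (φ x : Set M)) ∧
    ((¬ ∃ x : OMLSub L, OMLSub.IsBlock x ∧ (x : Set L).ncard = 4) →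
      ∃! f : OMLIso L M, ∀ x : OMLSub L, f '' (x : Set L) = (φ x : Set M)) := by
  obtain ⟨f, hf⟩ := exists_isMatching φ
  refine ⟨⟨hf.toOMLIso, hf.image_eq⟩, fun hL => ⟨hf.toOMLIso, hf.image_eq, fun g hg => ?_⟩⟩
  refine OMLIso.ext fun a => ?_
  by_cases ha : a = ⊥
  · rw [ha]
    exact (map_bot g.toRelIso).trans (map_bot hf.toOMLIso.toRelIso).symm
  by_cases ha' : a = ⊤
  · rw [ha']
    exact (map_top g.toRelIso).trans (map_top hf.toOMLIso.toRelIso).symm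
  by_cases h : ∃ b c, Triad a b c
  · obtain ⟨b, c, h⟩ := h
    exact OMLIso.eq_of_triad hg hf.image_eq h
  by_cases h' : ∃ b c, Triad aᶜ b c
  · obtain ⟨b, c, h'⟩ := h'
    have := OMLIso.eq_of_triad (g := hf.toOMLIso) hg hf.image_eq h'
    exact compl_inj_iff.1 ((g.map_compl a).symm.trans (this.trans (hf.map_compl a)))
  push Not at h h'
  exact absurd ⟨gen a, isBlock_gen ha ha' h h', ncard_gen ha ha'⟩ hL
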